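/- Let $G=(V,E)$ be a finite acyclic directed multigraph (parallel channels allowed, all channels of unit capacity) with a single source $s$ that has no incoming channels and a set $T\subseteq V\setminus\{s\}$ of sinks that have no outgoing channels; nodes in $V\setminus(\{s\}\cup T)$ are called internal. For a channel $e$ from node $i$ to node $j$ write $\mathrm{tail}(e)=i$, $\mathrm{head}(e)=j$; $In(v)$ and $Out(v)$ are the sets of channels with head $v$ and with tail $v$. For $t\in T$ let $C_t$ be the minimum number of channels whose removal disconnects $t$ from $s$. Let $\mathbb F$ be a field. An $n$-dimensional $\mathbb F$-valued linear network error correction code on $G$ consists of a local encoding kernel at each non-sink node: at $s$ a matrix $(k_{d_i',e})$, $1\le i\le n$, $e\in Out(s)$, where $d_1',\dots,d_n'$ are imaginary message channels entering $s$, and at each internal node $v$ a matrix $(k_{d,e})$, $d\in In(v)$, $e\in Out(v)$, with entries in $\mathbb F$. Its extended global encoding kernels $\tilde f_e\in\mathbb F^{n+|E|}$, $e\in E$, with coordinates indexed by $\{d_1',\dots,d_n'\}\cup E$, are defined recursively by $$\tilde f_e=\sum_{d}k_{d,e}\tilde f_d+1_e,\qquad \tilde f_{d_i'}=1_{d_i'},$$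 where $1_x$ is the unit vector at coordinate $x$ and $d$ runs over $In(\mathrm{tail}(e))$, or over $d_1',\dots,d_n'$ if $\mathrm{tail}(e)=s$. For $t\in T$ let $F_t$ ($n\times|In(t)|$) and $G_t$ ($|E|\times|In(t)|$) be the upper and lower blocks of the matrix with columns $\tilde f_e$, $e\in In(t)$. The message space is $\Phi(t)=\{XF_t: X\in\mathbb F^n\}$, and the error space of an error pattern $\rho\subseteq E$ is $\Delta(t,\rho)=\{ZG_t: Z\in\mathbb F^{E},\ Z_e=0\text{ for all }e\notin\rho\}$. The pattern $\rho$ is dominated by $\rho'$ with respect to $t$ if $\Delta(t,\rho)\subseteq\Delta(t,\rho')$ for every $\mathbb F$-valued linear network code on $G$, and $rank_t(\rho)$ is the minimum of $|\rho'|$ over all $\rho'$ that dominate $\rho$. The code is regular if $\dim\Phi(t)=n$ for all $t\in T$; its minimum distance at $t$ is $d^{(t)}_{\min}=\min\{rank_t(\rho):\dim(\Delta(t,\rho)\cap\Phi(t))>0\}$. A network MDS code is a regular code with $d_{\min}^{(t)}=C_t-n+1$ for all $t\in T$. **Corollary.** Let $\omega$ be a positive integer with $\omega\le C_t$ for all $t\in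 T$. If $$|\mathbb F|>\max_{1\le i\le\omega}\ \sum_{t\in T}\binom{|E|}{C_t-i},$$ then there is a family of variable-rate $\mathbb F$-valued network MDS codes of dimensions $1,2,\dots,\omega$ on $G$, that is, for each $n\in\{1,\dots,\omega\}$ an $n$-dimensional $\mathbb F$-valued network MDS code, such that all these codes have the same local encoding kernel at each internal node. -/

import Mathlib

/-- A single-source multicast network: a finite acyclic directed multigraph with node type `V` and
channel type `E` (parallel channels are allowed, every channel has unit capacity), a source without
incoming channels, and a set of sinks, none of which has outgoing channels. -/
structure Network (V E : Type*) where
  tail : E → V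
  head : E → V
  source : V
  sinks : Finset V
  acyclic : ∀ v : V, ¬ Relation.TransGen (fun u w : V => ∃ e : E, tail e = u ∧ head e = w) v v
  source_notMem_sinks : source ∉ sinks
  head_ne_source : ∀ e : E, head e ≠ source
  tail_notMem_sinks : ∀ e : E, tail e ∉ sinks

namespace Network

variable {V E : Type*}

/-- The incoming (real) channels of a node. -/
abbrev In (G : Network V E) (v : V) : Type _ := {e : E // G.head e = v}

/-- The outgoing channels of a node. -/
abbrev Out (G : Network V E) (v : V) : Type _ := {e : E // G.tail e = v}

/-- The internal nodes are the nodes that are neither the source nor a sink. -/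
def IsInternal (G : Network V E) (v : V) : Prop := v ≠ G.source ∧ v ∉ G.sinks

/-- A set `A` of channels is a cut between `u` and `v` if no directed path from `u` to `v` is left
after the channels in `A` have been removed. -/
def IsCut (G : Network V E) (A : Finset E) (u v : V) : Prop :=
  ¬ Relation.ReflTransGen (fun x y : V => ∃ e : E, e ∉ A ∧ G.tail e = x ∧ G.head e = y) u v

/-- The minimum cut capacity `C_t` between the source and the node `t`. -/
noncomputable def minCut (G : Network V E) (t : V) : ℕ :=
  sInf {n : ℕ | ∃ A : Finset E, G.IsCut A G.source t ∧ A.card = n}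

/-- In a finite acyclic network the relation "`d` enters the node that `e` leaves" is well-founded;
this is the upstream-to-downstream order along which the encoding kernels are computed. -/
theorem wellFounded_adj [Finite E] (G : Network V E) :
    WellFounded (fun d e : E => G.head d = G.tail e) := by
  have key : ∀ d e : E, Relation.TransGen (fun d e : E => G.head d = G.tail e) d e →
      Relation.TransGen (fun u w : V => ∃ e : E, G.tail e = u ∧ G.head e = w)
        (G.tail d) (G.tail e) := by
    intro d e h
    induction h with
    | single h => exact Relation.TransGen.single ⟨d, rfl, h⟩
    | @tail b c _ hbc ih => exact Relation.TransGen.tail ih ⟨b, rfl, hbc⟩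
  have hirr : Std.Irrefl (Relation.TransGen (fun d e : E => G.head d = G.tail e)) :=
    ⟨fun e h => G.acyclic _ (key e e h)⟩
  have hwf : WellFounded (Relation.TransGen (fun d e : E => G.head d = G.tail e)) :=
    Finite.wellFounded_of_trans_of_irrefl _
  exact Subrelation.wf
    (r := Relation.TransGen (fun d e : E => G.head d = G.tail e))
    (fun {_ _} h => Relation.TransGen.single h) hwf

end Network

/-- An `n`-dimensional `F`-valued linear network error correction code on `G`, in its local
description: an `n × |Out(s)|` local encoding kernel at the source `s`, whose rows belong to the
`n` imaginary message channels, and an `|In(v)| × |Out(v)|` local encoding kernel at every other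
node `v`.
At `v = s` (no real incoming channels) and at the sinks (no outgoing channels) the matrix
`kernel v` has no entries, so `kernel` holds exactly the kernels at the internal nodes. -/
structure NetworkCode {V E : Type*} (G : Network V E) (F : Type*) (n : ℕ) where
  sourceKernel : Matrix (Fin n) (G.Out G.source) F
  kernel : ∀ v : V, Matrix (G.In v) (G.Out v) F

namespace NetworkCode

variable {V E F : Type*} [DecidableEq V] [Fintype E] [DecidableEq E] [Field F]
  {G : Network V E} {n : ℕ}

/-- The extended global encoding kernel of a channel `e`: the vector, with entries indexed by the
`n` imaginary message channels and by the channels in `E`, that is determined by the recursion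
`f_e = ∑_{d ∈ In(tail(e))} k_{d,e} f_d + 1_e`. If `tail(e)` is the source, then the sum is over the
imaginary message channels, whose kernels are the unit vectors. -/
noncomputable def extKernel (C : NetworkCode G F n) : E → (Fin n ⊕ E → F) :=
  G.wellFounded_adj.fix fun e f =>
    (if h : G.tail e = G.source then
        ∑ i : Fin n, C.sourceKernel i ⟨e, h⟩ • Pi.single (Sum.inl i) (1 : F)
      else
        ∑ d : G.In (G.tail e), C.kernel (G.tail e) d ⟨e, rfl⟩ • f d.1 d.2)
    + Pi.single (Sum.inr e) (1 : F)

theorem extKernel_eq (C : NetworkCode G F n) (e : E) :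
    C.extKernel e =
      (if h : G.tail e = G.source then
          ∑ i : Fin n, C.sourceKernel i ⟨e, h⟩ • Pi.single (Sum.inl i) (1 : F)
        else
          ∑ d : G.In (G.tail e), C.kernel (G.tail e) d ⟨e, rfl⟩ • C.extKernel d.1)
      + Pi.single (Sum.inr e) (1 : F) :=
  G.wellFounded_adj.fix_eq _ e

/-- The upper block `F_t` of the decoding matrix at `t`, with rows indexed by the imaginary message
channels. -/
noncomputable def messageMatrix (C : NetworkCode G F n) (t : V) : Matrix (Fin n) (G.In t) F :=
  Matrix.of fun i e => C.extKernel e.1 (Sum.inl i)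

/-- The lower block `G_t` of the decoding matrix at `t`, with rows indexed by the channels. -/
noncomputable def errorMatrix (C : NetworkCode G F n) (t : V) : Matrix E (G.In t) F :=
  Matrix.of fun d e => C.extKernel e.1 (Sum.inr d)

/-- The message space `Φ(t)`, consisting of all `X · F_t`. -/
noncomputable def messageSpace (C : NetworkCode G F n) (t : V) : Submodule F (G.In t → F) :=
  LinearMap.range (C.messageMatrix t).vecMulLinear

/-- The error vectors that match the error pattern `p`. -/
def matching (F : Type*) [Field F] {E : Type*} (p : Finset E) : Submodule F (E → F) where
  carrier := {Z | ∀ e, e ∉ p → Z e = 0}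
  add_mem' := fun {a b} ha hb e he => by
    show a e + b e = 0
    rw [ha e he, hb e he, add_zero]
  zero_mem' := fun _ _ => rfl
  smul_mem' := fun c x hx e he => by
    show c * x e = 0
    rw [hx e he, mul_zero]

/-- The error space `Δ(t, p)` of the error pattern `p`, consisting of all `Z · G_t` with `Z`
matching `p`. -/
noncomputable def errorSpace (C : NetworkCode G F n) (t : V) (p : Finset E) :
    Submodule F (G.In t → F) :=
  (matching F p).map (C.errorMatrix t).vecMulLinear

/-- The error pattern `p` is dominated by the error pattern `q` with respect to `t` if
`Δ(t, p) ⊆ Δ(t, q)` for every `F`-valued linear network code (of any dimension). -/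
def Dominated (G : Network V E) (F : Type*) [Field F] (t : V) (p q : Finset E) : Prop :=
  ∀ (m : ℕ) (C : NetworkCode G F m), C.errorSpace t p ≤ C.errorSpace t q

/-- The rank of the error pattern `p` with respect to `t`: the least size of an error pattern that
dominates `p`. -/
noncomputable def patternRank (G : Network V E) (F : Type*) [Field F] (t : V) (p : Finset E) : ℕ :=
  sInf {k : ℕ | ∃ q : Finset E, Dominated G F t p q ∧ q.card = k}

/-- A code is regular if `dim Φ(t) = n` at every sink `t`. -/
def IsRegular (C : NetworkCode G F n) : Prop :=
  ∀ t ∈ G.sinks, Module.finrank F (C.messageSpace t) = n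

/-- The minimum distance at `t`: the least rank of an error pattern `p` with
`dim (Δ(t, p) ∩ Φ(t)) > 0`. -/
noncomputable def minDist (C : NetworkCode G F n) (t : V) : ℕ :=
  sInf {k : ℕ | ∃ p : Finset E,
    0 < Module.finrank F ↥(C.errorSpace t p ⊓ C.messageSpace t) ∧ patternRank G F t p = k}

/-- A network MDS code is a regular code that attains the refined Singleton bound at every sink:
`d_min = C_t - n + 1` (written without subtraction). -/
def IsMDS (C : NetworkCode G F n) : Prop :=
  C.IsRegular ∧ ∀ t ∈ G.sinks, C.minDist t + n = G.minCut t + 1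

/-- `C 1, …, C ω` is a family of variable-rate network MDS codes: `C n` is an `n`-dimensional
network MDS code, and all of them have the same local encoding kernel at every internal node. -/
def IsVariableRateMDSFamily (ω : ℕ) (C : (n : ℕ) → NetworkCode G F n) : Prop :=
  (∀ n ∈ Finset.Icc 1 ω, (C n).IsMDS) ∧
    ∀ m ∈ Finset.Icc 1 ω, ∀ n ∈ Finset.Icc 1 ω, ∀ v : V, G.IsInternal v →
      (C m).kernel v = (C n).kernel v

end NetworkCode

/-!
A regular code attains the Singleton bound at `t` as soon as no nonzero message is confusable with
errors of rank at most `C_t - n`. Every pattern of such rank is dominated by a pattern `q` of full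
rank and size exactly `C_t - n`, so for each sink only these at most `|E|.choose (C_t - n)` patterns
have to be handled. A set of channels that every path from `q` to `t` meets dominates `q` and so has
at least `|q|` elements, and a cut between the source and `t` has at least `C_t ≥ |q| + n` elements.
Hence, by Hall's theorem, there are channel-disjoint paths to `t` from the `n` message channels and
from the channels in `q`. These paths select a square submatrix of `1 - K`, with `K` the matrix of
all local encoding coefficients, whose determinant is a nonzero polynomial of degree at most one in
each coefficient, and `q` is harmless wherever this polynomial does not vanish. A large field thus
has coefficients that work for all `t` and `q` simultaneously.

The code of dimension `n` is obtained from the code of dimension `n + 1` by precoding at the source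
alone: for each `q` of size `C_t - n` the messages confusable under `q` form at most a line, so a
hyperplane of messages that avoids all these lines can be used as the new message space.
-/

section LinearAlgebra

variable {K V W : Type*} [Field K] [AddCommGroup V] [Module K V] [AddCommGroup W] [Module K W]

theorem finrank_comap_sup_le [FiniteDimensional K V] (f : V →ₗ[K] W) (P R : Submodule K W)
    [FiniteDimensional K R] :
    Module.finrank K ((P ⊔ R).comap f) ≤ Module.finrank K (P.comap f) + Module.finrank K R := by
  set h : (P ⊔ R).comap f →ₗ[K] W ⧸ P := (P.mkQ ∘ₗ f).domRestrict ((P ⊔ R).comap f) with hh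
  have hrange : Module.finrank K (LinearMap.range h) ≤ Module.finrank K R := by
    refine (Submodule.finrank_mono ?_).trans (Submodule.finrank_map_le P.mkQ R)
    rintro _ ⟨⟨x, hx⟩, rfl⟩
    obtain ⟨y, hy, z, hz, hyz⟩ := Submodule.mem_sup.mp (Submodule.mem_comap.mp hx)
    refine ⟨z, hz, ?_⟩
    simp [hh, ← hyz, (Submodule.Quotient.mk_eq_zero P).mpr hy]
  have hker : Module.finrank K (LinearMap.ker h) ≤ Module.finrank K (P.comap f) := by
    rw [hh, LinearMap.ker_domRestrict, LinearMap.ker_comp, Submodule.ker_mkQ,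
      ← Submodule.finrank_map_subtype_eq, Submodule.map_comap_subtype]
    exact Submodule.finrank_mono inf_le_right
  have := h.finrank_range_add_finrank_ker
  lia

theorem exists_matrix_vecMul_mem {ι : Type*} [Finite ι] (U : Submodule K (ι → K)) {m : ℕ}
    (hm : m ≤ Module.finrank K U) :
    ∃ A : Matrix (Fin m) ι K,
      (∀ x, Matrix.vecMul x A = 0 → x = 0) ∧ ∀ x, Matrix.vecMul x A ∈ U := by
  obtain ⟨b, hb⟩ := exists_linearIndependent_of_le_finrank hm
  have hbA : LinearIndependent K (Matrix.of fun i => (b i : ι → K)).row :=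
    hb.map' U.subtype U.ker_subtype
  refine ⟨Matrix.of fun i => (b i : ι → K), fun x hx => ?_, fun x => ?_⟩
  · exact Matrix.vecMul_injective_iff.mpr hbA (hx.trans (Matrix.zero_vecMul _).symm)
  · rw [Matrix.vecMul_eq_sum]
    exact U.sum_mem fun i _ => U.smul_mem _ (b i).2

end LinearAlgebra

section Polynomials

variable {σ R : Type*} [CommRing R]

theorem exists_forall_eval_ne_zero [IsDomain R] [Finite σ] {ι : Type*} (I : Finset ι)
    (P : ι → MvPolynomial σ R) (hP : ∀ i ∈ I, P i ≠ 0)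
    (hdeg : ∀ a, ((∑ i ∈ I, (P i).degreeOf a : ℕ) : ℕ∞) < ENat.card R) :
    ∃ x : σ → R, ∀ i ∈ I, MvPolynomial.eval x (P i) ≠ 0 := by
  have hS : ∀ a, ∃ S : Finset R, ∑ i ∈ I, (P i).degreeOf a < S.card := by
    intro a
    have hcard := Order.add_one_le_of_lt (hdeg a)
    obtain ⟨S, hS⟩ := Cardinal.exists_finset_eq_card
      (Cardinal.natCast_le_toENat.mp (by exact_mod_cast hcard))
    exact ⟨S, by lia⟩
  choose S hS using hS
  by_contra! hroot
  refine Finset.prod_ne_zero_iff.mpr hP <|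
    MvPolynomial.eq_zero_of_eval_zero_at_prod_finset _ S
      (fun a => (MvPolynomial.degreeOf_prod_le a I P).trans_lt (hS a)) fun x _ => ?_
  obtain ⟨i, hi, hx⟩ := hroot x
  rw [map_prod]
  exact Finset.prod_eq_zero hi hx

theorem degreeOf_det_le {m : Type*} [Fintype m] [DecidableEq m] {a : σ}
    {M : Matrix m m (MvPolynomial σ R)} {c : m → ℕ}
    (hM : ∀ i j, (M i j).degreeOf a ≤ c j) : M.det.degreeOf a ≤ ∑ j, c j := by
  rw [Matrix.det_apply]
  refine (MvPolynomial.degreeOf_sum_le _ _ _).trans (Finset.sup_le fun π _ => ?_)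
  have hsign : ∀ P : MvPolynomial σ R, (Equiv.Perm.sign π • P).degreeOf a = P.degreeOf a := by
    intro P
    rcases Int.units_eq_one_or (Equiv.Perm.sign π) with h | h <;> simp [h]
  rw [hsign]
  exact (MvPolynomial.degreeOf_prod_le _ _ _).trans (Finset.sum_le_sum fun j _ => hM (π j) j)

theorem det_ne_zero_of_wellFounded [IsDomain R] {m : Type*} [Fintype m] [DecidableEq m]
    {M : Matrix m m R} {r : m → m → Prop} (hr : WellFounded r) (hdiag : ∀ i, M i i ≠ 0)
    (hoff : ∀ i j, i ≠ j → M i j ≠ 0 → r j i) : M.det ≠ 0 := by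
  rw [Ne, ← Matrix.exists_mulVec_eq_zero_iff]
  rintro ⟨v, hv, hMv⟩
  refine hv (funext fun i => ?_)
  induction i using hr.induction with
  | _ i ih =>
    have hi : ∑ j, M i j * v j = 0 := congrFun hMv i
    rw [Finset.sum_eq_single i] at hi
    · exact (mul_eq_zero.mp hi).resolve_left (hdiag i)
    · intro j _ hji
      by_cases hij : M i j = 0
      · rw [hij, zero_mul]
      · rw [ih j (hoff i j hji.symm hij), Pi.zero_apply, mul_zero]
    · simp

end Polynomials

section Dual

variable {ι K V : Type*} [Field K] [AddCommGroup V] [Module K V] [FiniteDimensional K V]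

theorem exists_dual_forall_apply_ne_zero (I : Finset ι) (v : ι → V) (hv : ∀ i ∈ I, v i ≠ 0)
    (hK : (I.card : ℕ∞) < ENat.card K) : ∃ f : Module.Dual K V, ∀ i ∈ I, f (v i) ≠ 0 := by
  classical
  set b := Module.finBasis K V
  let P : ι → MvPolynomial (Fin (Module.finrank K V)) K :=
    fun i => ∑ s, MvPolynomial.C (b.repr (v i) s) * MvPolynomial.X s
  have heval : ∀ i u, MvPolynomial.eval u (P i) = b.constr K u (v i) := fun i u => by
    simp [P, Module.Basis.constr_apply_fintype, Module.Basis.equivFun_apply]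
  have hP : ∀ i ∈ I, P i ≠ 0 := fun i hi hPi => by
    refine hv i hi (b.ext_elem fun s => ?_)
    have := heval i (Pi.single s 1)
    simpa [hPi, Module.Basis.constr_apply_fintype, Pi.single_apply] using this.symm
  have hdeg : ∀ i a, (P i).degreeOf a ≤ 1 := fun i a => by
    refine (MvPolynomial.degreeOf_sum_le _ _ _).trans (Finset.sup_le fun s _ => ?_)
    refine (MvPolynomial.degreeOf_C_mul_le _ _ _).trans ?_
    rw [MvPolynomial.degreeOf_X]
    split_ifs <;> simp
  obtain ⟨u, hu⟩ := exists_forall_eval_ne_zero I P hP fun a => by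
    refine lt_of_le_of_lt ?_ hK
    exact_mod_cast (Finset.sum_le_card_nsmul I _ 1 fun i _ => hdeg i a).trans_eq (by simp)
  exact ⟨b.constr K u, fun i hi => heval i u ▸ hu i hi⟩

theorem exists_dual_forall_disjoint_ker (I : Finset ι) (U : ι → Submodule K V)
    (hU : ∀ i ∈ I, Module.finrank K (U i) ≤ 1) (hK : (I.card : ℕ∞) < ENat.card K) :
    ∃ f : Module.Dual K V, ∀ i ∈ I, Disjoint (LinearMap.ker f) (U i) := by
  classical
  have hspan : ∀ i ∈ I, ∃ v, U i = K ∙ v := fun i hi =>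
    ((U i).finrank_le_one_iff_isPrincipal.mp (hU i hi)).principal
  choose! v hv using hspan
  obtain ⟨f, hf⟩ := exists_dual_forall_apply_ne_zero (I.filter (v · ≠ 0)) v
    (fun i hi => (Finset.mem_filter.mp hi).2)
    ((Nat.cast_le.mpr (Finset.card_filter_le _ _)).trans_lt hK)
  refine ⟨f, fun i hi => ?_⟩
  by_cases hvi : v i = 0
  · simp [hv i hi, hvi]
  · rw [hv i hi, Submodule.disjoint_span_singleton' hvi, LinearMap.mem_ker]
    exact hf i (Finset.mem_filter.mpr ⟨hi, hvi⟩)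

end Dual

theorem wellFounded_of_forall_not_transGen {α : Type*} [Finite α] {r : α → α → Prop}
    (hr : ∀ a, ¬ Relation.TransGen r a a) : WellFounded r :=
  have : Std.Irrefl (Relation.TransGen r) := ⟨hr⟩
  Subrelation.wf (r := Relation.TransGen r) .single (Finite.wellFounded_of_trans_of_irrefl _)

namespace Network

variable {V E : Type*} (G : Network V E) {n : ℕ}

/-- The node that an extended channel enters: the imaginary message channels enter the source. -/
def extHead : Fin n ⊕ E → V :=
  Sum.elim (fun _ => G.source) G.head

/-- The adjacency relation between extended channels: `y` leaves the node that `x` enters. -/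
def ExtAdj (x y : Fin n ⊕ E) : Prop :=
  ∃ e, y = Sum.inr e ∧ G.extHead x = G.tail e

theorem head_ne_tail (e : E) : G.head e ≠ G.tail e :=
  fun h => G.acyclic _ (.single ⟨e, rfl, h⟩)

theorem not_transGen_extAdj (x : Fin n ⊕ E) : ¬ Relation.TransGen G.ExtAdj x x := fun h =>
  G.acyclic _ <| h.lift G.extHead fun _ _ ⟨e, hy, hx⟩ => ⟨e, hx.symm, hy ▸ rfl⟩

theorem wellFounded_extAdj [Finite E] : WellFounded (G.ExtAdj (n := n)) :=
  wellFounded_of_forall_not_transGen G.not_transGen_extAdj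

theorem wellFounded_swap_extAdj [Finite E] :
    WellFounded (Function.swap (G.ExtAdj (n := n))) :=
  wellFounded_of_forall_not_transGen fun x h =>
    G.not_transGen_extAdj x (Relation.transGen_swap.mp h)

/-- The error pattern `q` screens the set `S` of extended channels from `t` if every path from a
channel in `S` to `t` meets `q` after its first channel. The condition is stated locally: no
channel in `S` enters `t`, and every successor of a channel in `S` lies in `q` or again in `S`. -/
def Screens (t : V) (q : Finset E) (S : Set (Fin n ⊕ E)) : Prop :=
  ∀ x ∈ S, G.extHead x ≠ t ∧ ∀ e, G.extHead x = G.tail e → e ∈ q ∨ Sum.inr e ∈ S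

variable {G} {t : V} {q : Finset E} {S : Set (Fin n ⊕ E)}

theorem Screens.restrict (h : G.Screens t q S) (m : ℕ) :
    G.Screens t q (Sum.inr '' (Sum.inr ⁻¹' S) : Set (Fin m ⊕ E)) := by
  rintro _ ⟨d, hd, rfl⟩
  exact ⟨(h _ hd).1, fun e he => ((h _ hd).2 e he).imp_right (⟨e, ·, rfl⟩)⟩

theorem Screens.isCut (h : G.Screens t q S) {i : Fin n} (hi : Sum.inl i ∈ S) :
    G.IsCut q G.source t := by
  have hreach : ∀ v, Relation.ReflTransGen
      (fun x y : V => ∃ e : E, e ∉ q ∧ G.tail e = x ∧ G.head e = y) G.source v →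
      ∃ x ∈ S, G.extHead x = v := by
    intro v hv
    induction hv with
    | refl => exact ⟨_, hi, rfl⟩
    | tail _ hvw ih =>
      obtain ⟨e, heq, rfl, rfl⟩ := hvw
      obtain ⟨x, hx, hxe⟩ := ih
      exact ⟨_, ((h x hx).2 e hxe).resolve_left heq, rfl⟩
  intro ht
  obtain ⟨x, hx, hxt⟩ := hreach t ht
  exact (h x hx).1 hxt

theorem IsCut.exists_screens (h : G.IsCut q G.source t) (n : ℕ) :
    ∃ S : Set (Fin n ⊕ E), G.Screens t q S ∧ ∀ i, Sum.inl i ∈ S := by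
  refine ⟨{x | Relation.ReflTransGen
    (fun x y : V => ∃ e : E, e ∉ q ∧ G.tail e = x ∧ G.head e = y) G.source (G.extHead x)},
    fun x hx => ⟨fun hxt => h (hxt ▸ hx), fun e he => or_iff_not_imp_left.mpr fun heq => ?_⟩,
    fun _ => .refl⟩
  exact hx.tail ⟨e, heq, he.symm, rfl⟩

theorem minCut_le_card (h : G.IsCut q G.source t) : G.minCut t ≤ q.card :=
  Nat.sInf_le ⟨q, h, rfl⟩

theorem sink_ne_source (ht : t ∈ G.sinks) : t ≠ G.source :=
  fun h => G.source_notMem_sinks (h ▸ ht)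

theorem isCut_in [DecidableEq V] [Fintype E] (ht : t ≠ G.source) :
    G.IsCut {e | G.head e = t} G.source t := by
  intro h
  obtain rfl | ⟨_, -, e, he, -, het⟩ := h.cases_tail
  · exact ht rfl
  · exact he (by simpa using het)

theorem exists_isCut_card_eq [Finite E] (ht : t ≠ G.source) :
    ∃ A : Finset E, G.IsCut A G.source t ∧ A.card = G.minCut t := by
  classical
  have := Fintype.ofFinite E
  exact Nat.sInf_mem (s := {k | ∃ A : Finset E, G.IsCut A G.source t ∧ A.card = k})
    ⟨_, _, isCut_in ht, rfl⟩

end Network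

namespace NetworkCode

section Kernels

variable {V E F : Type*} [DecidableEq V] [Field F] {G : Network V E} {n : ℕ}

/-- The local encoding coefficients from the message channels to all channels, extended by zero to
the channels that do not leave the source. -/
def sourceTransfer (C : NetworkCode G F n) : Matrix (Fin n) E F :=
  Matrix.of fun i e => if h : G.tail e = G.source then C.sourceKernel i ⟨e, h⟩ else 0

/-- The local encoding coefficients between channels, extended by zero to the pairs of channels
that are not adjacent. -/
def transfer (C : NetworkCode G F n) : Matrix E E F :=
  Matrix.of fun d e => if h : G.head d = G.tail e then C.kernel (G.tail e) ⟨d, h⟩ ⟨e, rfl⟩ else 0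

/-- All local encoding coefficients in one matrix, with rows indexed by the extended channels. -/
def localKernel (C : NetworkCode G F n) : Matrix (Fin n ⊕ E) E F :=
  Matrix.fromRows C.sourceTransfer C.transfer

theorem localKernel_eq_zero (C : NetworkCode G F n) {x : Fin n ⊕ E} {e : E}
    (h : G.extHead x ≠ G.tail e) : C.localKernel x e = 0 := by
  cases x with
  | inl i => exact dif_neg (Ne.symm h)
  | inr d => exact dif_neg h

variable [Fintype E]

theorem sum_in_kernel_mul (C : NetworkCode G F n) (e : E) (f : E → F) :
    ∑ d : G.In (G.tail e), C.kernel (G.tail e) d ⟨e, rfl⟩ * f d = ∑ d, f d * C.transfer d e := by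
  rw [← Fintype.sum_subtype_add_sum_subtype (fun d => G.head d = G.tail e),
    Finset.sum_eq_zero (s := .univ (α := {d // ¬ G.head d = G.tail e})), add_zero]
  · refine Finset.sum_congr rfl fun d _ => ?_
    rw [mul_comm, transfer, Matrix.of_apply, dif_pos d.2]
  · exact fun d _ => mul_eq_zero_of_right _ (dif_neg d.2)

variable [DecidableEq E]

/-- The matrix whose columns are the extended global encoding kernels of all channels. -/
noncomputable def globalKernel (C : NetworkCode G F n) : Matrix (Fin n ⊕ E) E F :=
  Matrix.of fun x e => C.extKernel e x

/-- The matrix with columns `f_e`, `e ∈ In(t)`, that a sink uses for decoding; the upper and lower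
blocks of it are `messageMatrix` and `errorMatrix`. -/
noncomputable def decodingMatrix (C : NetworkCode G F n) (t : V) :
    Matrix (Fin n ⊕ E) (G.In t) F :=
  C.globalKernel.submatrix id (↑)

theorem globalKernel_eq_add_mul (C : NetworkCode G F n) :
    C.globalKernel = Matrix.fromRows C.sourceTransfer 1 + C.globalKernel * C.transfer := by
  ext x e
  have hx := congrFun (C.extKernel_eq e) x
  by_cases hs : G.tail e = G.source
  · have htransfer : ∀ d, C.transfer d e = 0 :=
      fun d => dif_neg fun hd => G.head_ne_source d (hd.trans hs)
    rw [dif_pos hs] at hx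
    cases x <;> simp_all [globalKernel, Matrix.mul_apply, sourceTransfer, Pi.single_apply,
      Matrix.one_apply]
  · have hsource : ∀ i, C.sourceTransfer i e = 0 := fun i => dif_neg hs
    rw [dif_neg hs, Pi.add_apply, Finset.sum_apply] at hx
    simp only [Pi.smul_apply, smul_eq_mul, C.sum_in_kernel_mul e fun d => C.extKernel d x] at hx
    cases x <;> simp_all [globalKernel, Matrix.mul_apply, Pi.single_apply, Matrix.one_apply,
      add_comm]

theorem globalKernel_mul_one_sub (C : NetworkCode G F n) :
    C.globalKernel * (1 - C.transfer) = Matrix.fromRows C.sourceTransfer 1 := by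
  rw [Matrix.mul_sub, Matrix.mul_one, sub_eq_iff_eq_add]
  exact C.globalKernel_eq_add_mul

theorem one_sub_transfer_mul (C : NetworkCode G F n) :
    (1 - C.transfer) * C.globalKernel.toRows₂ = 1 := by
  rw [mul_eq_one_comm]
  have h := congrArg Matrix.toRows₂ C.globalKernel_mul_one_sub
  rwa [Matrix.toRows₂_fromRows] at h

theorem globalKernel_eq_mul (C : NetworkCode G F n) :
    C.globalKernel = Matrix.fromRows C.sourceTransfer 1 * C.globalKernel.toRows₂ := by
  rw [← C.globalKernel_mul_one_sub, Matrix.mul_assoc, C.one_sub_transfer_mul, Matrix.mul_one]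

theorem toRows₁_globalKernel (C : NetworkCode G F n) :
    C.globalKernel.toRows₁ = C.sourceTransfer * C.globalKernel.toRows₂ := by
  conv_lhs => rw [C.globalKernel_eq_mul, Matrix.fromRows_mul, Matrix.toRows₁_fromRows]

theorem globalKernel_eq_add_localKernel_mul (C : NetworkCode G F n) :
    C.globalKernel = Matrix.fromRows 0 1 + C.localKernel * C.globalKernel.toRows₂ := by
  have h := C.one_sub_transfer_mul
  rw [Matrix.sub_mul, Matrix.one_mul, sub_eq_iff_eq_add] at h
  conv_lhs => rw [C.globalKernel_eq_mul]
  rw [localKernel, Matrix.fromRows_mul, Matrix.fromRows_mul, Matrix.one_mul]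
  ext (i | d) e
  · simp
  · simpa using congrFun (congrFun h d) e

theorem decodingMatrix_apply_of_extHead_ne (C : NetworkCode G F n) {t : V} {x : Fin n ⊕ E}
    (hx : G.extHead x ≠ t) :
    C.decodingMatrix t x = ∑ e, C.localKernel x e • C.errorMatrix t e := by
  ext b
  have hxb : (Matrix.fromRows 0 1 : Matrix (Fin n ⊕ E) E F) x b = 0 := by
    rcases x with i | d
    · rfl
    · exact Matrix.one_apply_ne fun h => hx (h ▸ b.2)
  have h := congrFun (congrFun C.globalKernel_eq_add_localKernel_mul x) b
  rw [Matrix.add_apply, hxb, zero_add, Matrix.mul_apply] at h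
  rw [Finset.sum_apply]
  exact h

theorem errorSpace_eq_span (C : NetworkCode G F n) (t : V) (p : Finset E) :
    C.errorSpace t p = Submodule.span F ((C.errorMatrix t).row '' p) := by
  apply le_antisymm
  · rintro _ ⟨Z, hZ, rfl⟩
    rw [Matrix.vecMulLinear_apply, Matrix.vecMul_eq_sum]
    refine Submodule.sum_mem _ fun e _ => ?_
    by_cases he : e ∈ p
    · exact Submodule.smul_mem _ _ (Submodule.subset_span ⟨e, he, rfl⟩)
    · rw [hZ e he, zero_smul]
      exact Submodule.zero_mem _
  · rw [Submodule.span_le]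
    rintro _ ⟨e, he, rfl⟩
    exact ⟨Pi.single e 1, fun d hd => Pi.single_eq_of_ne (by rintro rfl; exact hd he) _,
      Matrix.single_one_vecMul _ _⟩

theorem errorMatrix_mem_errorSpace (C : NetworkCode G F n) (t : V) {p : Finset E} {e : E}
    (he : e ∈ p) : C.errorMatrix t e ∈ C.errorSpace t p := by
  rw [errorSpace_eq_span]
  exact Submodule.subset_span ⟨e, he, rfl⟩

theorem errorSpace_mono (C : NetworkCode G F n) (t : V) {p q : Finset E} (h : p ⊆ q) :
    C.errorSpace t p ≤ C.errorSpace t q := by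
  rw [errorSpace_eq_span, errorSpace_eq_span]
  exact Submodule.span_mono (Set.image_mono (Finset.coe_subset.mpr h))

theorem errorSpace_union (C : NetworkCode G F n) (t : V) (p q : Finset E) :
    C.errorSpace t (p ∪ q) = C.errorSpace t p ⊔ C.errorSpace t q := by
  simp only [errorSpace_eq_span, Finset.coe_union, Set.image_union, Submodule.span_union]

theorem finrank_errorSpace_le (C : NetworkCode G F n) (t : V) (p : Finset E) :
    Module.finrank F (C.errorSpace t p) ≤ p.card := by
  classical
  rw [errorSpace_eq_span, ← Finset.coe_image]
  exact (finrank_span_finset_le_card _).trans Finset.card_image_le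

theorem decodingMatrix_mem_errorSpace (C : NetworkCode G F n) {t : V} {q : Finset E}
    {S : Set (Fin n ⊕ E)} (hS : G.Screens t q S) {x : Fin n ⊕ E} (hx : x ∈ S) :
    C.decodingMatrix t x ∈ C.errorSpace t q := by
  induction x using G.wellFounded_swap_extAdj.induction with
  | _ x ih =>
    obtain ⟨hxt, hsucc⟩ := hS x hx
    rw [C.decodingMatrix_apply_of_extHead_ne hxt]
    refine Submodule.sum_mem _ fun e _ => ?_
    by_cases he : G.extHead x = G.tail e
    · refine Submodule.smul_mem _ _ ?_
      rcases hsucc e he with heq | heS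
      · exact C.errorMatrix_mem_errorSpace t heq
      · exact ih (Sum.inr e) ⟨e, rfl, he⟩ heS
    · rw [C.localKernel_eq_zero he, zero_smul]
      exact Submodule.zero_mem _

theorem messageSpace_le_errorSpace (C : NetworkCode G F n) {t : V} {A : Finset E}
    (hA : G.IsCut A G.source t) : C.messageSpace t ≤ C.errorSpace t A := by
  obtain ⟨S, hS, hinl⟩ := hA.exists_screens n
  rintro _ ⟨X, rfl⟩
  rw [Matrix.vecMulLinear_apply, Matrix.vecMul_eq_sum]
  exact Submodule.sum_mem _ fun i _ =>
    Submodule.smul_mem _ _ (C.decodingMatrix_mem_errorSpace hS (hinl i))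

end Kernels

section Domination

variable {V E : Type*} [DecidableEq V] [Fintype E] [DecidableEq E] {G : Network V E}
  {F : Type*} [Field F] {n : ℕ} {t : V} {p q r : Finset E}

theorem dominated_of_subset (h : p ⊆ q) : Dominated G F t p q :=
  fun _ C => C.errorSpace_mono t h

theorem Dominated.trans (hpq : Dominated G F t p q) (hqr : Dominated G F t q r) :
    Dominated G F t p r :=
  fun m C => (hpq m C).trans (hqr m C)

theorem Dominated.union (hp : Dominated G F t p q) (r : Finset E) :
    Dominated G F t (p ∪ r) (q ∪ r) := fun m C => by
  rw [errorSpace_union, errorSpace_union]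
  exact sup_le_sup_right (hp m C) _

theorem dominated_of_screens {S : Set (Fin n ⊕ E)} (hS : G.Screens t q S)
    (hp : ∀ e ∈ p, e ∈ q ∨ Sum.inr e ∈ S) : Dominated G F t p q := by
  intro m C
  rw [C.errorSpace_eq_span t p, Submodule.span_le]
  rintro _ ⟨e, he, rfl⟩
  rcases hp e he with heq | heS
  · exact C.errorMatrix_mem_errorSpace t heq
  · exact C.decodingMatrix_mem_errorSpace (hS.restrict m) ⟨e, heS, rfl⟩

theorem patternRank_le_of_dominated (h : Dominated G F t p q) : patternRank G F t p ≤ q.card :=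
  Nat.sInf_le ⟨q, h, rfl⟩

theorem patternRank_le_card (p : Finset E) : patternRank G F t p ≤ p.card :=
  patternRank_le_of_dominated (dominated_of_subset subset_rfl)

variable (G F t) in
theorem exists_dominated_card_eq (p : Finset E) :
    ∃ q, Dominated G F t p q ∧ q.card = patternRank G F t p :=
  Nat.sInf_mem (s := {k | ∃ q : Finset E, Dominated G F t p q ∧ q.card = k})
    ⟨_, p, dominated_of_subset subset_rfl, rfl⟩

theorem Dominated.patternRank_le (h : Dominated G F t p q) :
    patternRank G F t p ≤ patternRank G F t q := by
  obtain ⟨r, hr, hcard⟩ := exists_dominated_card_eq G F t q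
  exact hcard ▸ patternRank_le_of_dominated (h.trans hr)

variable (G F) in
open Classical in
/-- The error patterns of size `k` whose rank with respect to `t` is `k`. -/
noncomputable def fullRankPatterns (t : V) (k : ℕ) : Finset (Finset E) :=
  {p ∈ Finset.powersetCard k Finset.univ | patternRank G F t p = k}

theorem mem_fullRankPatterns {k : ℕ} :
    p ∈ fullRankPatterns G F t k ↔ p.card = k ∧ patternRank G F t p = k := by
  simp [fullRankPatterns, Finset.mem_powersetCard]

variable (G F) in
theorem card_fullRankPatterns_le (t : V) (k : ℕ) :
    (fullRankPatterns G F t k).card ≤ (Fintype.card E).choose k :=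
  (Finset.card_filter_le _ _).trans_eq (Finset.card_powersetCard k Finset.univ)

end Domination

section Confusable

variable {V E F : Type*} [DecidableEq V] [Fintype E] [DecidableEq E] [Field F]
  {G : Network V E} {n : ℕ}

/-- The messages `X` that a sink `t` may confuse with the zero message when the errors match `p`,
because `X · F_t ∈ Δ(t, p)`. -/
noncomputable def confusable (C : NetworkCode G F n) (t : V) (p : Finset E) :
    Submodule F (Fin n → F) :=
  (C.errorSpace t p).comap (C.messageMatrix t).vecMulLinear

theorem confusable_le_of_dominated (C : NetworkCode G F n) {t : V} {p q : Finset E}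
    (h : Dominated G F t p q) : C.confusable t p ≤ C.confusable t q :=
  Submodule.comap_mono (h n C)

theorem confusable_eq_top_of_isCut (C : NetworkCode G F n) {t : V} {A : Finset E}
    (hA : G.IsCut A G.source t) : C.confusable t A = ⊤ :=
  top_le_iff.mp fun X _ => C.messageSpace_le_errorSpace hA ⟨X, rfl⟩

theorem finrank_confusable_le (C : NetworkCode G F n) (t : V) {p q : Finset E} (h : p ⊆ q) :
    Module.finrank F (C.confusable t q) ≤
      Module.finrank F (C.confusable t p) + (q \ p).card := by
  rw [← Finset.union_sdiff_of_subset h, confusable, errorSpace_union,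
    Finset.union_sdiff_cancel_left Finset.disjoint_sdiff]
  exact (finrank_comap_sup_le _ _ _).trans
    (Nat.add_le_add_left (C.finrank_errorSpace_le t _) _)

/-- At every sink, no nonzero message is confusable with the zero message under errors whose
pattern has rank at most `C_t - n`. -/
def Separates (C : NetworkCode G F n) : Prop :=
  ∀ t ∈ G.sinks, ∀ p, patternRank G F t p + n ≤ G.minCut t → C.confusable t p = ⊥

theorem Separates.injective_message {C : NetworkCode G F n} (hC : C.Separates) {t : V}
    (ht : t ∈ G.sinks) (hn : n ≤ G.minCut t) :
    Function.Injective (C.messageMatrix t).vecMulLinear := by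
  have hrank : patternRank G F t ∅ = 0 := Nat.le_zero.mp (patternRank_le_card ∅)
  rw [← LinearMap.ker_eq_bot, eq_bot_iff, ← hC t ht ∅ (by rwa [hrank, zero_add])]
  exact LinearMap.ker_le_comap _

theorem finrank_errorSpace_inf_messageSpace_pos_iff {C : NetworkCode G F n} {t : V}
    (hinj : Function.Injective (C.messageMatrix t).vecMulLinear) {p : Finset E} :
    0 < Module.finrank F ↥(C.errorSpace t p ⊓ C.messageSpace t) ↔ C.confusable t p ≠ ⊥ := by
  rw [messageSpace, inf_comm, ← Submodule.map_comap_eq, ← confusable, Nat.pos_iff_ne_zero,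
    Ne, Submodule.finrank_eq_zero, (Submodule.map_injective_of_injective hinj).eq_iff'
      (Submodule.map_bot _)]

theorem exists_confusable_ne_bot (C : NetworkCode G F n) {t : V} (ht : t ≠ G.source)
    (hn : 1 ≤ n) (hcut : n ≤ G.minCut t) :
    ∃ p : Finset E, p.card + n = G.minCut t + 1 ∧ C.confusable t p ≠ ⊥ := by
  obtain ⟨A, hA, hAcard⟩ := Network.exists_isCut_card_eq ht
  obtain ⟨p, hpA, hp⟩ : ∃ p ⊆ A, p.card = G.minCut t + 1 - n :=
    Finset.exists_subset_card_eq (by lia)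
  refine ⟨p, by lia, fun hbot => ?_⟩
  have hle := C.finrank_confusable_le t hpA
  rw [C.confusable_eq_top_of_isCut hA, finrank_top, hbot, finrank_bot, Module.finrank_fin_fun,
    Finset.card_sdiff_of_subset hpA] at hle
  lia

theorem Separates.minDist_add {C : NetworkCode G F n} (hC : C.Separates) (hn : 1 ≤ n) {t : V}
    (ht : t ∈ G.sinks) (hcut : n ≤ G.minCut t) : C.minDist t + n = G.minCut t + 1 := by
  have hpos := fun p =>
    finrank_errorSpace_inf_messageSpace_pos_iff (hC.injective_message ht hcut) (p := p)
  obtain ⟨p, hpcard, hp⟩ := C.exists_confusable_ne_bot (Network.sink_ne_source ht) hn hcut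
  have hmem : patternRank G F t p ∈ {k : ℕ | ∃ p : Finset E,
      0 < Module.finrank F ↥(C.errorSpace t p ⊓ C.messageSpace t) ∧ patternRank G F t p = k} :=
    ⟨p, (hpos p).mpr hp, rfl⟩
  have hle : C.minDist t ≤ p.card := (Nat.sInf_le hmem).trans (patternRank_le_card p)
  obtain ⟨q, hq, hqrank⟩ : ∃ q : Finset E,
      0 < Module.finrank F ↥(C.errorSpace t q ⊓ C.messageSpace t) ∧
        patternRank G F t q = C.minDist t := Nat.sInf_mem ⟨_, hmem⟩
  have hge : G.minCut t < patternRank G F t q + n := by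
    by_contra! hlt
    exact (hpos q).mp hq (hC t ht q hlt)
  lia

theorem Separates.isMDS {C : NetworkCode G F n} (hC : C.Separates) (hn : 1 ≤ n)
    (hcut : ∀ t ∈ G.sinks, n ≤ G.minCut t) : C.IsMDS := by
  refine ⟨fun t ht => ?_, fun t ht => hC.minDist_add hn ht (hcut t ht)⟩
  rw [messageSpace, LinearMap.finrank_range_of_inj (hC.injective_message ht (hcut t ht)),
    Module.finrank_fin_fun]

end Confusable

end NetworkCode

namespace Network

section Routing

variable {V E : Type*} {G : Network V E} {n : ℕ} {t : V}

/-- A routing to `t`, encoded as a successor map `φ` on the extended channels that do not enter `t`: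
the fixed points are the channels that stay unused, and following `φ` from the message channels and
from the channels outside of its range gives channel-disjoint paths to `t`. -/
structure IsRouting (φ : {x : Fin n ⊕ E // G.extHead x ≠ t} → E) : Prop where
  injective : Function.Injective φ
  eq_or_extHead_eq : ∀ x, x.1 = Sum.inr (φ x) ∨ G.extHead x.1 = G.tail (φ x)

theorem IsRouting.extHead_eq_tail_iff {φ : {x : Fin n ⊕ E // G.extHead x ≠ t} → E}
    (hφ : G.IsRouting φ) (x) : G.extHead x.1 = G.tail (φ x) ↔ x.1 ≠ Sum.inr (φ x) :=
  ⟨fun h hx => G.head_ne_tail (φ x) (by rwa [hx] at h), (hφ.eq_or_extHead_eq x).resolve_left⟩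

theorem IsRouting.exists_superset [Finite E] {φ : {x : Fin n ⊕ E // G.extHead x ≠ t} → E}
    (hφ : G.IsRouting φ) (ht : t ≠ G.source) {q : Finset E} (hq : ∀ x, φ x ∉ q)
    (hcard : q.card + n ≤ G.minCut t) :
    ∃ p : Finset E, q ⊆ p ∧ p.card = G.minCut t - n ∧ ∀ x, φ x ∉ p := by
  classical
  have := Fintype.ofFinite E
  have hsub : q ⊆ (Finset.univ.image φ)ᶜ := fun e he => by
    simp only [Finset.mem_compl, Finset.mem_image, Finset.mem_univ, true_and]
    rintro ⟨x, rfl⟩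
    exact hq x he
  have hrows : Fintype.card {x : Fin n ⊕ E // G.extHead x ≠ t} =
      n + Fintype.card {e // G.head e ≠ t} := by
    rw [Fintype.card_congr Equiv.subtypeSum, Fintype.card_sum,
      Fintype.card_of_subtype Finset.univ fun i => by simpa [extHead] using ht.symm,
      Finset.card_univ, Fintype.card_fin]
    rfl
  have hcompl : G.minCut t - n ≤ ((Finset.univ.image φ)ᶜ).card := by
    rw [Finset.card_compl, Finset.card_image_of_injective _ hφ.injective, Finset.card_univ, hrows,
      Fintype.card_subtype]
    have hin := minCut_le_card (isCut_in ht)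
    have hsplit := Finset.card_filter_add_card_filter_not (s := Finset.univ) (G.head · = t)
    rw [Finset.card_univ] at hsplit
    lia
  obtain ⟨p, hqp, hp, hpcard⟩ := Finset.exists_subsuperset_card_eq hsub (by lia) hcompl
  exact ⟨p, hqp, hpcard, fun x hx => by simpa using hp hx⟩

variable [DecidableEq V] [Fintype E] [DecidableEq E]

variable (G) in
/-- The channels that belong to `S` or directly succeed an extended channel in `S`. -/
def closedSucc (S : Finset (Fin n ⊕ E)) : Finset E :=
  {e | ∃ x ∈ S, x = Sum.inr e ∨ G.extHead x = G.tail e}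

theorem mem_closedSucc {S : Finset (Fin n ⊕ E)} {e : E} :
    e ∈ G.closedSucc S ↔ ∃ x ∈ S, x = Sum.inr e ∨ G.extHead x = G.tail e := by
  simp [closedSucc]

theorem toRight_subset_closedSucc (S : Finset (Fin n ⊕ E)) : S.toRight ⊆ G.closedSucc S :=
  fun e he => mem_closedSucc.mpr ⟨Sum.inr e, Finset.mem_toRight.mp he, .inl rfl⟩

theorem screens_closedSucc_sdiff_toRight {S : Finset (Fin n ⊕ E)}
    (hS : ∀ x ∈ S, G.extHead x ≠ t) :
    G.Screens t (G.closedSucc S \ S.toRight) (S : Set (Fin n ⊕ E)) := by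
  refine fun x hx => ⟨hS x hx, fun e he => or_iff_not_imp_right.mpr fun heS => ?_⟩
  exact Finset.mem_sdiff.mpr
    ⟨mem_closedSucc.mpr ⟨x, hx, .inr he⟩, fun h => heS (Finset.mem_toRight.mp h)⟩

end Routing

end Network

namespace NetworkCode

section Hall

variable {V E : Type*} [DecidableEq V] [Fintype E] [DecidableEq E] {G : Network V E}
  {F : Type*} [Field F] {n : ℕ} {t : V} {q : Finset E}

open Network

theorem card_le_card_closedSucc_sdiff (hq : patternRank G F t q = q.card)
    (hcard : q.card + n ≤ G.minCut t) {S : Finset (Fin n ⊕ E)} (hS : ∀ x ∈ S, G.extHead x ≠ t) :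
    S.card ≤ (G.closedSucc S \ q).card := by
  have hscreens := screens_closedSucc_sdiff_toRight hS
  set W := G.closedSucc S
  have hScard := S.card_toLeft_add_card_toRight
  have hWS := Finset.card_sdiff_add_card_eq_card (toRight_subset_closedSucc (G := G) S)
  have hWq := Finset.card_sdiff_add_card_inter W q
  rcases S.toLeft.eq_empty_or_nonempty with hleft | ⟨i, hi⟩
  · have hdom : Dominated G F t q (W \ S.toRight ∪ q \ W) := by
      refine .trans (dominated_of_subset ?_)
        ((dominated_of_screens hscreens (p := q ∩ W) fun e he => ?_).union (q \ W))
      · rw [Finset.union_comm, Finset.sdiff_union_inter]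
      · by_cases heS : Sum.inr e ∈ S
        · exact .inr heS
        · exact .inl (by simp_all)
    have hrank := hq ▸ patternRank_le_of_dominated hdom
    have hunion := Finset.card_union_le (W \ S.toRight) (q \ W)
    have hqW := Finset.card_sdiff_add_card_inter q W
    rw [Finset.inter_comm] at hqW
    rw [hleft, Finset.card_empty] at hScard
    lia
  · have hcut := minCut_le_card (hscreens.isCut (Finset.mem_toLeft.mp hi))
    have hleft := card_finset_fin_le S.toLeft
    have hinter := Finset.card_le_card (Finset.inter_subset_right : W ∩ q ⊆ q)
    lia

theorem exists_isRouting (hq : patternRank G F t q = q.card) (hcard : q.card + n ≤ G.minCut t) :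
    ∃ φ : {x : Fin n ⊕ E // G.extHead x ≠ t} → E, G.IsRouting φ ∧ ∀ x, φ x ∉ q := by
  let T (x : {x : Fin n ⊕ E // G.extHead x ≠ t}) : Finset E :=
    {e | (x.1 = Sum.inr e ∨ G.extHead x.1 = G.tail e) ∧ e ∉ q}
  obtain ⟨φ, hinj, hφ⟩ := (Finset.all_card_le_biUnion_card_iff_exists_injective T).mp fun s => by
    have hT : s.biUnion T = G.closedSucc (s.map (.subtype _)) \ q := by
      ext e
      simp [T, mem_closedSucc, ← and_assoc, exists_and_right]
    rw [hT, ← Finset.card_map (.subtype _)]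
    exact card_le_card_closedSucc_sdiff hq hcard fun x hx => by
      obtain ⟨y, -, rfl⟩ := Finset.mem_map.mp hx
      exact y.2
  have hmem := fun x => (Finset.mem_filter.mp (hφ x)).2
  exact ⟨φ, ⟨hinj, fun x => (hmem x).1⟩, fun x => (hmem x).2⟩

end Hall

section RoutingMatrix

variable {V E : Type*} {G : Network V E} {n : ℕ} {t : V}

section

variable [DecidableEq V]

variable (G) in
/-- The entries of `k` between adjacent channels, with all other entries replaced by zero. -/
def mask {R : Type*} [Zero R] (k : Matrix (Fin n ⊕ E) E R) : Matrix (Fin n ⊕ E) E R :=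
  Matrix.of fun x e => if G.extHead x = G.tail e then k x e else 0

variable (G) in
/-- The code with the local encoding coefficients `k`. -/
def ofCoeff {F : Type*} (k : Matrix (Fin n ⊕ E) E F) : NetworkCode G F n where
  sourceKernel := Matrix.of fun i e => k (Sum.inl i) e
  kernel _ := Matrix.of fun d e => k (Sum.inr d) e

theorem localKernel_ofCoeff {F : Type*} [Field F] (k : Matrix (Fin n ⊕ E) E F) :
    (ofCoeff G k).localKernel = mask G k := by
  ext (i | d) e
  · simp [localKernel, sourceTransfer, mask, ofCoeff, Network.extHead, eq_comm]
  · by_cases h : G.head d = G.tail e <;>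
      simp [localKernel, transfer, mask, ofCoeff, Network.extHead, h]

end

variable [DecidableEq E]

/-- The square submatrix of `identity - L` that is selected by `φ`, where `L` holds local encoding
coefficients and the rows of the identity are extended by zero rows for the message channels. -/
def routingMatrix {R : Type*} [CommRing R] (φ : {x : Fin n ⊕ E // G.extHead x ≠ t} → E)
    (L : Matrix (Fin n ⊕ E) E R) :
    Matrix {x : Fin n ⊕ E // G.extHead x ≠ t} {x : Fin n ⊕ E // G.extHead x ≠ t} R :=
  (Matrix.fromRows 0 1 - L).submatrix Subtype.val φ

theorem routingMatrix_apply {R : Type*} [CommRing R]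
    {φ : {x : Fin n ⊕ E // G.extHead x ≠ t} → E} {L : Matrix (Fin n ⊕ E) E R} (x y) :
    routingMatrix φ L x y = (if x.1 = Sum.inr (φ y) then 1 else 0) - L x (φ y) := by
  rcases x with ⟨i | d, hx⟩ <;> simp [routingMatrix, Matrix.one_apply]

variable [DecidableEq V] [Fintype E] {R : Type*} [CommRing R]
  {φ : {x : Fin n ⊕ E // G.extHead x ≠ t} → E}

theorem map_det_routingMatrix_mask {S : Type*} [CommRing S] (f : R →+* S)
    (k : Matrix (Fin n ⊕ E) E R) :
    f (routingMatrix φ (mask G k)).det = (routingMatrix φ (mask G (k.map f))).det := by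
  rw [RingHom.map_det]
  congr 1
  ext x y
  simp only [RingHom.mapMatrix_apply, Matrix.map_apply, routingMatrix_apply, mask, Matrix.of_apply]
  split_ifs <;> simp

theorem degreeOf_det_routingMatrix_le [Nontrivial R] (hφ : Function.Injective φ)
    (a : (Fin n ⊕ E) × E) :
    (routingMatrix φ (mask G (Matrix.mvPolynomialX _ _ R))).det.degreeOf a ≤ 1 := by
  refine (degreeOf_det_le (c := fun y => if φ y = a.2 then 1 else 0) fun x y => ?_).trans ?_
  · simp only [routingMatrix_apply, mask, Matrix.of_apply, Matrix.mvPolynomialX_apply]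
    refine (MvPolynomial.degreeOf_sub_le _ _ _).trans (max_le ?_ ?_)
    · split_ifs <;> simp
    · simp only [apply_ite (MvPolynomial.degreeOf a), MvPolynomial.degreeOf_X,
        MvPolynomial.degreeOf_zero, Prod.ext_iff, eq_comm (a := a.2)]
      split_ifs <;> simp_all
  · rw [Finset.sum_boole]
    exact Finset.card_le_one.mpr fun x hx y hy => hφ (by simp_all)

theorem exists_det_routingMatrix_ne_zero [IsDomain R] (hφ : G.IsRouting φ) :
    ∃ k : Matrix (Fin n ⊕ E) E R, (routingMatrix φ (mask G k)).det ≠ 0 := by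
  classical
  let k : Matrix (Fin n ⊕ E) E R := Matrix.of fun x e => if ∃ y, y.1 = x ∧ φ y = e then -1 else 0
  have hwf : WellFounded fun x y : {x : Fin n ⊕ E // G.extHead x ≠ t} => G.ExtAdj x.1 y.1 :=
    InvImage.wf Subtype.val G.wellFounded_extAdj
  refine ⟨k, det_ne_zero_of_wellFounded hwf (fun x => ?_) fun x y hxy hentry => ?_⟩
  · have hkx : k x (φ x) = -1 := if_pos ⟨x, rfl, rfl⟩
    rw [routingMatrix_apply, mask, Matrix.of_apply, hkx]
    have := hφ.extHead_eq_tail_iff x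
    split_ifs <;> simp_all
  · have hkxy : k x (φ y) = 0 :=
      if_neg fun ⟨z, hzx, hzy⟩ => hxy ((Subtype.ext hzx).symm.trans (hφ.injective hzy))
    rw [routingMatrix_apply, mask, Matrix.of_apply, hkxy, ite_self, sub_zero] at hentry
    have hx : x.1 = Sum.inr (φ y) := by_contra fun h => hentry (if_neg h)
    exact ⟨φ y, hx, (hφ.extHead_eq_tail_iff y).mpr fun hy => hxy (Subtype.ext (hx.trans hy.symm))⟩

theorem det_routingMatrix_mvPolynomialX_ne_zero [IsDomain R] (hφ : G.IsRouting φ) :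
    (routingMatrix φ (mask G (Matrix.mvPolynomialX _ _ R))).det ≠ 0 := by
  obtain ⟨k, hk⟩ := exists_det_routingMatrix_ne_zero (R := R) hφ
  intro h
  have heval := map_det_routingMatrix_mask (φ := φ) (MvPolynomial.eval fun a => k a.1 a.2)
    (Matrix.mvPolynomialX _ _ R)
  rw [h, map_zero] at heval
  refine hk ?_
  convert heval.symm
  ext x e
  simp

end RoutingMatrix

section Decoding

variable {V E F : Type*} [DecidableEq V] [Fintype E] [DecidableEq E] [Field F]
  {G : Network V E} {n : ℕ} {t : V} {φ : {x : Fin n ⊕ E // G.extHead x ≠ t} → E} {p : Finset E}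

open Matrix

theorem decodingMatrix_eq_fromRows (C : NetworkCode G F n) (t : V) :
    C.decodingMatrix t = fromRows (C.messageMatrix t) (C.errorMatrix t) := by
  ext (i | d) e <;> rfl

theorem sumElim_vecMul_sub_localKernel (C : NetworkCode G F n) (u : Fin n ⊕ E → F) :
    Sum.elim (u ∘ Sum.inl) (u ᵥ* C.globalKernel) ᵥ* (fromRows 0 1 - C.localKernel) =
      u ∘ Sum.inr := by
  have h : u ᵥ* C.globalKernel = u ᵥ* fromRows C.sourceTransfer 1 +
      u ᵥ* C.globalKernel ᵥ* C.transfer := by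
    conv_lhs => rw [C.globalKernel_eq_add_mul, vecMul_add, ← vecMul_vecMul]
  rw [vecMul_fromRows, vecMul_one] at h
  rw [vecMul_sub, localKernel, sumElim_vecMul_fromRows, sumElim_vecMul_fromRows, vecMul_zero,
    zero_add, vecMul_one, sub_eq_iff_eq_add]
  nth_rewrite 1 [h]
  abel

theorem eq_zero_of_vecMul_decodingMatrix_eq_zero {C : NetworkCode G F n} (ht : t ≠ G.source)
    (hdet : (routingMatrix φ C.localKernel).det ≠ 0) {u : Fin n ⊕ E → F}
    (hu : ∀ x, u (Sum.inr (φ x)) = 0) (hdecode : u ᵥ* C.decodingMatrix t = 0) : u = 0 := by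
  set w : Fin n ⊕ E → F := Sum.elim (u ∘ Sum.inl) (u ᵥ* C.globalKernel)
  have hflow : w ᵥ* (fromRows 0 1 - C.localKernel) = u ∘ Sum.inr :=
    C.sumElim_vecMul_sub_localKernel u
  have hsink : ∀ x, G.extHead x = t → w x = 0 := by
    rintro (i | e) hx
    · exact absurd hx.symm ht
    · exact congrFun hdecode ⟨e, hx⟩
  have hrows : (fun x : {x : Fin n ⊕ E // G.extHead x ≠ t} => w x) = 0 := by
    refine eq_zero_of_vecMul_eq_zero hdet (funext fun y => ?_)
    have hsplit := Fintype.sum_subtype_add_sum_subtype (G.extHead · ≠ t)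
      fun x => w x * (fromRows 0 1 - C.localKernel : Matrix (Fin n ⊕ E) E F) x (φ y)
    rw [Finset.sum_eq_zero (s := .univ (α := {x // ¬ G.extHead x ≠ t})) fun x _ => by
      rw [hsink x (not_not.mp x.2), zero_mul], add_zero] at hsplit
    exact hsplit.trans ((congrFun hflow (φ y)).trans (hu y))
  have hw0 : w = 0 := funext fun x => by
    by_cases hx : G.extHead x = t
    · exact hsink x hx
    · exact congrFun hrows ⟨x, hx⟩
  ext (i | e)
  · exact congrFun hw0 (Sum.inl i)
  · exact (congrFun hflow e).symm.trans (by rw [hw0, zero_vecMul]; rfl)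

theorem confusable_eq_bot {C : NetworkCode G F n} (ht : t ≠ G.source)
    (hdet : (routingMatrix φ C.localKernel).det ≠ 0) (hp : ∀ x, φ x ∉ p) :
    C.confusable t p = ⊥ := by
  refine eq_bot_iff.mpr fun X hX => ?_
  obtain ⟨Z, hZ, hZX⟩ := hX
  have hu := eq_zero_of_vecMul_decodingMatrix_eq_zero (u := Sum.elim X (-Z)) ht hdet
    (fun x => by simp [hZ _ (hp x)]) <| by
      rw [decodingMatrix_eq_fromRows, sumElim_vecMul_fromRows, neg_vecMul]
      exact add_neg_eq_zero.mpr hZX.symm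
  exact funext fun i => congrFun hu (Sum.inl i)

theorem finrank_errorSpace_eq_card {C : NetworkCode G F n} (ht : t ≠ G.source)
    (hdet : (routingMatrix φ C.localKernel).det ≠ 0) (hp : ∀ x, φ x ∉ p) :
    Module.finrank F (C.errorSpace t p) = p.card := by
  have hindep : LinearIndepOn F (C.errorMatrix t).row (p : Set E) := by
    refine linearIndepOn_finset_iff.mpr fun Z hZ e he => ?_
    have hu := eq_zero_of_vecMul_decodingMatrix_eq_zero
      (u := Sum.elim 0 fun e => if e ∈ p then Z e else 0) ht hdet
      (fun x => if_neg (hp x)) <| by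
        rw [decodingMatrix_eq_fromRows, sumElim_vecMul_fromRows, zero_vecMul, zero_add, ← hZ,
          vecMul_eq_sum]
        simp [ite_smul, row]
    simpa [he] using congrFun hu (Sum.inr e)
  rw [errorSpace_eq_span, Set.image_eq_range]
  exact (finrank_span_eq_card hindep).trans (Fintype.card_coe p)

theorem patternRank_eq_card {C : NetworkCode G F n}
    (hC : Module.finrank F (C.errorSpace t p) = p.card) : patternRank G F t p = p.card := by
  obtain ⟨q, hq, hcard⟩ := exists_dominated_card_eq G F t p
  refine (patternRank_le_card p).antisymm ?_
  rw [← hC, ← hcard]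
  exact (Submodule.finrank_mono (hq n C)).trans (C.finrank_errorSpace_le t q)

end Decoding

section Separation

variable {V E : Type*} [DecidableEq V] [Fintype E] [DecidableEq E] {G : Network V E}
  {F : Type*} [Field F] {n : ℕ} {t : V}

theorem exists_dominated_mem_fullRankPatterns (ht : t ≠ G.source) {p : Finset E}
    (hp : patternRank G F t p + n ≤ G.minCut t) :
    ∃ q ∈ fullRankPatterns G F t (G.minCut t - n), Dominated G F t p q := by
  obtain ⟨r, hpr, hr⟩ := exists_dominated_card_eq G F t p
  have hrank : patternRank G F t r = r.card :=
    (patternRank_le_card r).antisymm (hr ▸ hpr.patternRank_le)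
  obtain ⟨φ, hφ, hφr⟩ := exists_isRouting hrank (hr ▸ hp)
  obtain ⟨q, hrq, hq, hφq⟩ := hφ.exists_superset ht hφr (hr ▸ hp)
  obtain ⟨k, hk⟩ := exists_det_routingMatrix_ne_zero (R := F) hφ
  rw [← localKernel_ofCoeff] at hk
  exact ⟨q, mem_fullRankPatterns.mpr
    ⟨hq, hq ▸ patternRank_eq_card (finrank_errorSpace_eq_card ht hk hφq)⟩,
    hpr.trans (dominated_of_subset hrq)⟩

theorem separates_of_fullRankPatterns {C : NetworkCode G F n}
    (hC : ∀ t ∈ G.sinks, ∀ q ∈ fullRankPatterns G F t (G.minCut t - n), C.confusable t q = ⊥) :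
    C.Separates := by
  intro t ht p hp
  obtain ⟨q, hq, hpq⟩ := exists_dominated_mem_fullRankPatterns (Network.sink_ne_source ht) hp
  exact eq_bot_mono (C.confusable_le_of_dominated hpq) (hC t ht q hq)

theorem exists_mvPolynomial_confusable_eq_bot (ht : t ≠ G.source) {q : Finset E}
    (hq : patternRank G F t q = q.card) (hcard : q.card + n ≤ G.minCut t) :
    ∃ P : MvPolynomial ((Fin n ⊕ E) × E) F, P ≠ 0 ∧ (∀ a, P.degreeOf a ≤ 1) ∧
      ∀ k, MvPolynomial.eval k P ≠ 0 →
        (ofCoeff G (Matrix.of fun x e => k (x, e))).confusable t q = ⊥ := by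
  obtain ⟨φ, hφ, hφq⟩ := exists_isRouting hq hcard
  refine ⟨_, det_routingMatrix_mvPolynomialX_ne_zero hφ,
    degreeOf_det_routingMatrix_le hφ.injective, fun k hk => ?_⟩
  refine confusable_eq_bot ht ?_ hφq
  rw [map_det_routingMatrix_mask] at hk
  rw [localKernel_ofCoeff]
  convert hk
  ext x e
  simp

variable (G F n) in
theorem exists_separates (hcut : ∀ t ∈ G.sinks, n ≤ G.minCut t)
    (hF : ((∑ t ∈ G.sinks, (fullRankPatterns G F t (G.minCut t - n)).card : ℕ) : ℕ∞) <
      ENat.card F) :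
    ∃ C : NetworkCode G F n, C.Separates := by
  set I := G.sinks.sigma fun t => fullRankPatterns G F t (G.minCut t - n)
  have hpoly : ∀ i ∈ I, ∃ P : MvPolynomial ((Fin n ⊕ E) × E) F, P ≠ 0 ∧
      (∀ a, P.degreeOf a ≤ 1) ∧ ∀ k, MvPolynomial.eval k P ≠ 0 →
        (ofCoeff G (Matrix.of fun x e => k (x, e))).confusable i.1 i.2 = ⊥ := by
    rintro ⟨t, q⟩ hi
    obtain ⟨ht, hq⟩ := Finset.mem_sigma.mp hi
    obtain ⟨hcard, hrank⟩ := mem_fullRankPatterns.mp hq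
    exact exists_mvPolynomial_confusable_eq_bot (Network.sink_ne_source ht)
      (hrank.trans hcard.symm) (by have := hcut t ht; lia)
  choose! P hP hdeg hconf using hpoly
  obtain ⟨k, hk⟩ := exists_forall_eval_ne_zero I P hP fun a => by
    refine lt_of_le_of_lt (Nat.cast_le.mpr ?_) hF
    refine (Finset.sum_le_card_nsmul I _ 1 fun i hi => hdeg i hi a).trans_eq ?_
    rw [smul_eq_mul, mul_one, Finset.card_sigma]
  exact ⟨_, separates_of_fullRankPatterns fun t ht q hq =>
    hconf ⟨t, q⟩ (Finset.mem_sigma.mpr ⟨ht, hq⟩) k (hk _ (Finset.mem_sigma.mpr ⟨ht, hq⟩))⟩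

end Separation

section Precoding

variable {V E F : Type*} [Field F] {G : Network V E} {m n : ℕ}

/-- The code of dimension `m` that encodes a message `X` by transmitting `X · A` with `C`. -/
def precode (C : NetworkCode G F n) (A : Matrix (Fin m) (Fin n) F) : NetworkCode G F m where
  sourceKernel := A * C.sourceKernel
  kernel := C.kernel

variable [DecidableEq V] (C : NetworkCode G F n) (A : Matrix (Fin m) (Fin n) F)

theorem sourceTransfer_precode : (C.precode A).sourceTransfer = A * C.sourceTransfer := by
  ext i e
  by_cases he : G.tail e = G.source <;>
    simp [sourceTransfer, precode, Matrix.mul_apply, he]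

variable [Fintype E] [DecidableEq E] (t : V)

theorem toRows₂_globalKernel_precode :
    (C.precode A).globalKernel.toRows₂ = C.globalKernel.toRows₂ :=
  (left_inv_eq_right_inv (mul_eq_one_comm.mp C.one_sub_transfer_mul)
    (C.precode A).one_sub_transfer_mul).symm

theorem toRows₁_globalKernel_precode :
    (C.precode A).globalKernel.toRows₁ = A * C.globalKernel.toRows₁ := by
  rw [toRows₁_globalKernel, toRows₂_globalKernel_precode, sourceTransfer_precode,
    toRows₁_globalKernel, Matrix.mul_assoc]

theorem errorMatrix_precode : (C.precode A).errorMatrix t = C.errorMatrix t :=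
  congrArg (fun M : Matrix E E F => M.submatrix id ((↑) : G.In t → E))
    (C.toRows₂_globalKernel_precode A)

theorem messageMatrix_precode : (C.precode A).messageMatrix t = A * C.messageMatrix t :=
  congrArg (fun M : Matrix (Fin m) E F => M.submatrix id ((↑) : G.In t → E))
    (C.toRows₁_globalKernel_precode A)

theorem confusable_precode (p : Finset E) :
    (C.precode A).confusable t p = (C.confusable t p).comap A.vecMulLinear := by
  rw [confusable, errorSpace, errorMatrix_precode, messageMatrix_precode, confusable,
    ← Submodule.comap_comp, ← errorSpace]
  congr 1
  exact LinearMap.ext fun X => (Matrix.vecMul_vecMul X A _).symm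

theorem Separates.finrank_confusable_le_one {C : NetworkCode G F (n + 1)} (hC : C.Separates)
    {t : V} (ht : t ∈ G.sinks) (hcut : n + 1 ≤ G.minCut t) {q : Finset E}
    (hq : q.card = G.minCut t - n) : Module.finrank F (C.confusable t q) ≤ 1 := by
  obtain ⟨e, he⟩ : q.Nonempty := Finset.card_pos.mp (by lia)
  have hcard := Finset.card_erase_of_mem he
  have hrank := patternRank_le_card (G := G) (F := F) (t := t) (q.erase e)
  have hle := C.finrank_confusable_le t (Finset.erase_subset e q)
  rwa [hC t ht (q.erase e) (by lia), finrank_bot, zero_add, Finset.sdiff_erase_self he,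
    Finset.card_singleton] at hle

theorem Separates.exists_precode {C : NetworkCode G F (n + 1)} (hC : C.Separates)
    (hcut : ∀ t ∈ G.sinks, n + 1 ≤ G.minCut t)
    (hF : ((∑ t ∈ G.sinks, (fullRankPatterns G F t (G.minCut t - n)).card : ℕ) : ℕ∞) <
      ENat.card F) :
    ∃ A : Matrix (Fin n) (Fin (n + 1)) F, (C.precode A).Separates := by
  set I := G.sinks.sigma fun t => fullRankPatterns G F t (G.minCut t - n)
  have hmem : ∀ t ∈ G.sinks, ∀ q ∈ fullRankPatterns G F t (G.minCut t - n), ⟨t, q⟩ ∈ I :=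
    fun t ht q hq => Finset.mem_sigma.mpr ⟨ht, hq⟩
  have hone : ∀ i ∈ I, Module.finrank F (C.confusable i.1 i.2) ≤ 1 := fun i hi =>
    hC.finrank_confusable_le_one (Finset.mem_sigma.mp hi).1 (hcut _ (Finset.mem_sigma.mp hi).1)
      (mem_fullRankPatterns.mp (Finset.mem_sigma.mp hi).2).1
  obtain ⟨f, hf⟩ := exists_dual_forall_disjoint_ker I _ hone (by rwa [Finset.card_sigma])
  have hker : n ≤ Module.finrank F (LinearMap.ker f) := by
    have hrank := f.finrank_range_add_finrank_ker
    have hrange := (LinearMap.range f).finrank_le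
    rw [Module.finrank_self] at hrange
    rw [Module.finrank_fin_fun] at hrank
    lia
  obtain ⟨A, hA, hAf⟩ := exists_matrix_vecMul_mem _ hker
  refine ⟨A, separates_of_fullRankPatterns fun t ht q hq => eq_bot_iff.mpr fun X hX => hA X ?_⟩
  rw [confusable_precode] at hX
  exact Submodule.disjoint_def.mp (hf _ (hmem t ht q hq)) _ (hAf X) hX

end Precoding

section VariableRate

variable {V E F : Type*} [DecidableEq V] [Fintype E] [DecidableEq E] [Field F]

theorem exists_kernel_forall_exists_separates (G : Network V E) (ω : ℕ)
    (hcut : ∀ t ∈ G.sinks, ω ≤ G.minCut t)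
    (hF : ∀ n ∈ Finset.Icc 1 ω,
      ((∑ t ∈ G.sinks, (fullRankPatterns G F t (G.minCut t - n)).card : ℕ) : ℕ∞) < ENat.card F) :
    ∃ K : ∀ v, Matrix (G.In v) (G.Out v) F,
      ∀ n ∈ Finset.Icc 1 ω, ∃ C : NetworkCode G F n, C.kernel = K ∧ C.Separates := by
  rcases Nat.eq_zero_or_pos ω with rfl | hω
  · exact ⟨0, by simp⟩
  obtain ⟨C, hC⟩ := exists_separates G F ω hcut (hF ω (Finset.mem_Icc.mpr ⟨hω, le_rfl⟩))
  suffices h : ∀ n ≤ ω, 1 ≤ n → ∃ D : NetworkCode G F n, D.kernel = C.kernel ∧ D.Separates from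
    ⟨C.kernel, fun n hn => h n (Finset.mem_Icc.mp hn).2 (Finset.mem_Icc.mp hn).1⟩
  intro n hnω hn
  induction hnω using Nat.decreasingInduction with
  | self => exact ⟨C, rfl, hC⟩
  | of_succ n hnω ih =>
    obtain ⟨D, hD, hDsep⟩ := ih (Nat.le_add_left 1 n)
    obtain ⟨A, hA⟩ := hDsep.exists_precode (fun t ht => (Nat.succ_le_of_lt hnω).trans (hcut t ht))
      (hF n (Finset.mem_Icc.mpr ⟨hn, hnω.le⟩))
    exact ⟨D.precode A, hD, hA⟩

end VariableRate

end NetworkCode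

theorem mainTheorem3_general {V E F : Type*} [DecidableEq V] [Fintype E] [DecidableEq E] [Field F]
    (G : Network V E) (ω : ℕ) (hω : ∀ t ∈ G.sinks, ω ≤ G.minCut t)
    (hF : (((Finset.Icc 1 ω).sup fun i =>
      ∑ t ∈ G.sinks, (NetworkCode.fullRankPatterns G F t (G.minCut t - i)).card : ℕ) : ℕ∞) <
        ENat.card F) :
    ∃ C : (n : ℕ) → NetworkCode G F n, NetworkCode.IsVariableRateMDSFamily ω C := by
  obtain ⟨K, hK⟩ := NetworkCode.exists_kernel_forall_exists_separates G ω hω fun n hn =>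
    (Nat.cast_le.mpr (Finset.le_sup (f := fun i => ∑ t ∈ G.sinks,
      (NetworkCode.fullRankPatterns G F t (G.minCut t - i)).card) hn)).trans_lt hF
  have : ∀ n, Nonempty (NetworkCode G F n) := fun n => ⟨⟨0, 0⟩⟩
  choose! C hkernel hsep using hK
  refine ⟨C, fun n hn => ?_, fun m hm n hn v _ => ?_⟩
  · obtain ⟨hn1, hnω⟩ := Finset.mem_Icc.mp hn
    exact (hsep n hn).isMDS hn1 fun t ht => hnω.trans (hω t ht)
  · rw [hkernel m hm, hkernel n hn]

theorem mainTheorem3 {V E F : Type*} [Fintype V] [DecidableEq V] [Fintype E] [DecidableEq E]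
    [Field F] (G : Network V E) (ω : ℕ)
    (hω : ∀ t ∈ G.sinks, ω ≤ G.minCut t)
    (hF : (((Finset.Icc 1 ω).sup fun i =>
      ∑ t ∈ G.sinks, (Fintype.card E).choose (G.minCut t - i) : ℕ) : ℕ∞) < ENat.card F) :
    ∃ C : (n : ℕ) → NetworkCode G F n, NetworkCode.IsVariableRateMDSFamily ω C :=
  mainTheorem3_general G ω hω <| lt_of_le_of_lt (Nat.cast_le.mpr <| Finset.sup_mono_fun fun _ _ =>
    Finset.sum_le_sum fun t _ => NetworkCode.card_fullRankPatterns_le G F t _) hF
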